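/- Let $\mathbb{K}$ be a field of characteristic zero. All gradings are homological gradings by $\mathbb{Z}$, and all sets of objects are small. A *dg category* is a category enriched in chain complexes of $\mathbb{K}$-modules. The category of dg categories carries Tabuada's model structure: a dg functor $F:\mathscr{A}\to\mathscr{B}$ is a weak equivalence if all the maps $F_{x,y}:\mathscr{A}(x,y)\to\mathscr{B}(Fx,Fy)$ are quasi-isomorphisms and $H_0(F)$ is an equivalence of categories; it is a fibration if all the maps $F_{x,y}$ are degreewise surjective and $H_0(F)$ is an isofibration; it is a cofibration if it has the left lifting property with respect to the fibrations that are weak equivalences. A *curved conilpotent cocategory* $\mathscr{C}$ consists of a set of objects $X$, a graded $\mathbb{K}$-module $\mathscr{C}(x,y)$ for each $(x,y)\in X^2$, degree $0$ maps $\Delta:\mathscr{C}(x,z)\to\bigoplus_{y}\mathscr{C}(x,y)\otimes\mathscr{C}(y,z)$ which are coassociative and conilpotent (every element is annihilated by some iterated decomposition), degree $-1$ maps $d:\mathscr{C}(x,y)\to\mathscr{C}(x,y)$ and degree $-2$ maps $\theta:\mathscr{C}(x,x)\to\mathbb{K}$ (extended by zero to $\mathscr{C}(x,y)$ for $x\neq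 y$), such that $$\Delta d=(d\otimes \mathrm{Id}+\mathrm{Id}\otimes d)\Delta,\qquad d^2=(\theta\otimes\mathrm{Id}-\mathrm{Id}\otimes\theta)\Delta,\qquad \theta d=0 .$$ A morphism is a function on objects together with degree $0$ linear maps $\mathscr{C}(x,y)\to\mathscr{D}(Fx,Fy)$ commuting with $\Delta$, $d$ and $\theta$. The *cobar construction* $\Omega_u\mathscr{C}$ is the dg category with the same objects whose underlying graded category is the tensor category $\mathbb{T}(s^{-1}\mathscr{C})$, free on the graded quiver $s^{-1}\mathscr{C}$, and whose differential is the derivation extending $$s^{-1}c\mapsto \theta(c)\,1-s^{-1}dc-\sum(-1)^{|c_1|}s^{-1}c_1\otimes s^{-1}c_2,\qquad \Delta c=\sum c_1\otimes c_2 .$$ It defines a functor $\Omega_u$ from curved conilpotent cocategories to dg categories. **Theorem.** There is no model structure on the category of curved conilpotent cocategories over $\mathbb{K}$ for which $\Omega_u$ sends cofibrations to cofibrations and weak equivalences to weak equivalences, where dg categories carry Tabuada's model structure. -/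

import Mathlib

open CategoryTheory

universe u

namespace CobarCat

open scoped TensorProduct DirectSum

noncomputable section

/-- A graded quiver with set of objects `X`: a `ℤ`-graded `K`-module for each pair of objects. -/
abbrev GradedQuiver (K : Type u) [Field K] (X : Type u) := X → X → ℤ → ModuleCat.{u} K

/-- A word from `x` to `z`: a string of objects `x = x₀, x₁, …, x_k = z` together with
integers `n₁, …, n_k` (the degrees of the letters). -/
inductive Word {X : Type u} (z : X) : X → Type u
  | nil : Word z z
  | cons (x : X) {y : X} (n : ℤ) (w : Word z y) : Word z x

section Tensor

variable {K : Type u} [Field K] {X : Type u}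

/-- `V(x₀,x₁)_{n₁} ⊗ ⋯ ⊗ V(x_{k-1},x_k)_{n_k}`, the empty tensor product being `K`. -/
def Word.tensor (V : GradedQuiver K X) {z : X} : {x : X} → Word z x → ModuleCat.{u} K
  | _, .nil => ModuleCat.of K K
  | _, @Word.cons _ _ x y n w => ModuleCat.of K (V x y n ⊗[K] w.tensor V)

/-- The morphisms from `x` to `z` in the tensor category `𝕋 V`: the direct sum, over all words
from `x` to `z`, of the tensor products above. -/
abbrev Tens (V : GradedQuiver K X) (x z : X) : Type u := ⨁ w : Word z x, w.tensor V

variable {V : GradedQuiver K X}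

namespace Tens

open Classical in
/-- The unit of `𝕋 V`, in the summand of the empty word. -/
def one (V : GradedQuiver K X) (x : X) : Tens V x x :=
  DirectSum.lof K (Word x x) (fun w => w.tensor V) Word.nil (1 : K)

/-- The unit if `x = z`, and zero otherwise. -/
def unit (V : GradedQuiver K X) (x z : X) : Tens V x z :=
  open Classical in if h : x = z then h ▸ one V x else 0

open Classical in
/-- The inclusion of the summand of the word `w`. -/
def incl (V : GradedQuiver K X) {x z : X} (w : Word z x) : w.tensor V →ₗ[K] Tens V x z :=
  DirectSum.lof K (Word z x) (fun w => w.tensor V) w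

open Classical in
/-- A linear map out of `𝕋 V` given on each summand. -/
def desc {x z : X} {M : Type u} [AddCommGroup M] [Module K M]
    (f : ∀ w : Word z x, w.tensor V →ₗ[K] M) : Tens V x z →ₗ[K] M :=
  DirectSum.toModule K (Word z x) M f

lemma desc_incl {x z : X} {M : Type u} [AddCommGroup M] [Module K M]
    (f : ∀ w : Word z x, w.tensor V →ₗ[K] M) (w : Word z x) (t : w.tensor V) :
    desc f (incl V w t) = f w t := by
  classical
  exact DirectSum.toModule_lof K _ _

/-- `v, t ↦ v ⊗ t`, adding one letter on the left. -/
def cons {x y z : X} {n : ℤ} : V x y n →ₗ[K] Tens V y z →ₗ[K] Tens V x z :=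
  LinearMap.flip (desc fun w =>
    LinearMap.flip ((TensorProduct.mk K (V x y n) (w.tensor V)).compr₂
      (incl V (Word.cons x n w))))

lemma cons_incl {x y z : X} {n : ℤ} (v : V x y n) (w : Word z y) (t : w.tensor V) :
    cons v (incl V w t) = incl V (Word.cons x n w) (v ⊗ₜ[K] t : V x y n ⊗[K] w.tensor V) := by
  unfold cons
  rw [LinearMap.flip_apply, desc_incl]
  rfl

/-- The generator of `𝕋 V` given by a one letter word. -/
def gen {x y : X} {n : ℤ} : V x y n →ₗ[K] Tens V x y := (cons (V := V)).flip (one V y)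

lemma gen_apply {x y : X} {n : ℤ} (v : V x y n) : gen v = cons v (one V y) := rfl

lemma incl_nil {z : X} (c : K) : incl V (Word.nil : Word z z) c = c • one V z := by
  have h := (incl V (Word.nil : Word z z)).map_smul c (1 : K)
  exact (congrArg (incl V (Word.nil : Word z z)) (_root_.mul_one c).symm).trans h

lemma incl_induction {z : X} {P : ∀ x : X, Word z x → Tens V x z → Prop}
    (zero : ∀ x w, P x w 0) (add : ∀ x w s t, P x w s → P x w t → P x w (s + t))
    (one : ∀ c : K, P z Word.nil (c • one V z))
    (cons : ∀ (x y : X) (n : ℤ) (v : V x y n) w t, P y w t → P x (Word.cons x n w) (cons v t))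
    {x : X} (w : Word z x) (t : w.tensor V) : P x w (incl V w t) := by
  induction w with
  | nil => exact (incl_nil (V := V) (z := z) t) ▸ one t
  | @cons x y n w ih =>
    change (V x y n ⊗[K] w.tensor V) at t
    induction t using TensorProduct.induction_on with
    | zero => erw [map_zero]; exact zero _ _
    | tmul v t => erw [← cons_incl]; exact cons _ _ _ _ _ _ (ih t)
    | add s t hs ht => erw [map_add]; exact add _ _ _ _ hs ht

lemma sum_induction {x z : X} {P : Tens V x z → Prop} (t : Tens V x z)
    (zero : P 0) (add : ∀ s t, P s → P t → P (s + t))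
    (h : ∀ w, P (incl V w (t w))) : P t := by
  classical
  rw [← DirectSum.sum_support_of t]
  refine Finset.sum_induction _ P add zero (fun w _ => h w)

lemma induction {z : X} {P : ∀ x : X, Tens V x z → Prop}
    (zero : ∀ x, P x 0) (add : ∀ x s t, P x s → P x t → P x (s + t))
    (one : ∀ c : K, P z (c • one V z))
    (cons : ∀ (x y : X) (n : ℤ) (v : V x y n) t, P y t → P x (cons v t))
    {x : X} (t : Tens V x z) : P x t :=
  sum_induction t (zero x) (add x) fun w =>
    incl_induction (P := fun x _ t => P x t) (fun x _ => zero x) (fun x _ => add x) one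
      (fun x y n v _ t => cons x y n v t) w _

/-- Two families of linear maps out of `𝕋 V` agree if they do so on units and this is preserved
by adding a letter. -/
lemma ext {z : X} {M : X → Type u} [∀ x, AddCommGroup (M x)] [∀ x, Module K (M x)]
    (f g : ∀ x, Tens V x z →ₗ[K] M x) (one : f z (one V z) = g z (one V z))
    (cons : ∀ (x y : X) (n : ℤ) (v : V x y n) t, f y t = g y t →
      f x (cons v t) = g x (cons v t)) {x : X} (t : Tens V x z) : f x t = g x t :=
  induction (P := fun x t => f x t = g x t) (by simp) (fun x s t hs ht => by simp [hs, ht])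
    (fun c => by simp [one]) cons t

/-- Recursion on words: for `b : M z` and maps `V(x,y)_n ⊗ M y → M x`, the induced maps
`(𝕋 V)(x,z) → M x`. -/
def foldWord {z : X} {M : X → Type u} [∀ x, AddCommGroup (M x)] [∀ x, Module K (M x)] (b : M z)
    (s : ∀ (x y : X) (n : ℤ), V x y n →ₗ[K] M y →ₗ[K] M x) :
    {x : X} → (w : Word z x) → w.tensor V →ₗ[K] M x
  | _, .nil => LinearMap.toSpanSingleton K (M z) b
  | _, @Word.cons _ _ x y n w =>
      TensorProduct.lift ((LinearMap.lcomp K (M x) (foldWord b s w)) ∘ₗ (s x y n))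

/-- Recursion on `𝕋 V`: the sum of the maps `foldWord`. -/
def fold {z : X} {M : X → Type u} [∀ x, AddCommGroup (M x)] [∀ x, Module K (M x)] (b : M z)
    (s : ∀ (x y : X) (n : ℤ), V x y n →ₗ[K] M y →ₗ[K] M x) {x : X} : Tens V x z →ₗ[K] M x :=
  desc (foldWord b s)

section fold
variable {z : X} {M : X → Type u} [∀ x, AddCommGroup (M x)] [∀ x, Module K (M x)] (b : M z)
    (s : ∀ (x y : X) (n : ℤ), V x y n →ₗ[K] M y →ₗ[K] M x)

lemma fold_one : fold b s (one V z) = b := by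
  have := desc_incl (foldWord b s) Word.nil (1 : K)
  refine this.trans ?_
  exact one_smul K b

lemma fold_cons {x y : X} {n : ℤ} (v : V x y n) (t : Tens V y z) :
    fold b s (cons v t) = s x y n v (fold b s t) := by
  refine sum_induction (P := fun t => fold b s (cons v t) = s x y n v (fold b s t)) t (by simp only [map_zero])
    (fun s t hs ht => by simp only [map_add, hs, ht]) fun w => ?_
  unfold fold
  rw [cons_incl, desc_incl (foldWord b s) w]
  exact (desc_incl (foldWord b s) (Word.cons x n w) _).trans rfl

end fold

/-- The composition of `𝕋 V`: concatenation of words. -/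
def mul {x y z : X} : Tens V x y →ₗ[K] Tens V y z →ₗ[K] Tens V x z :=
  fold (M := fun x => Tens V y z →ₗ[K] Tens V x z) LinearMap.id
    fun _ _ _ => LinearMap.llcomp K _ _ _ ∘ₗ cons

lemma one_mul {x y : X} (t : Tens V x y) : mul (one V x) t = t := by
  unfold mul; rw [fold_one]; rfl

lemma cons_mul {x y z z' : X} {n : ℤ} (v : V x y n) (s : Tens V y z) (t : Tens V z z') :
    mul (cons v s) t = cons v (mul s t) := by
  unfold mul; rw [fold_cons]; rfl

lemma mul_one {x y : X} (t : Tens V x y) : mul t (one V y) = t :=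
  ext (fun x => (mul (x := x)).flip (one V y)) (fun _ => LinearMap.id) (one_mul _)
    (fun x y n v t h => by
      simp only [LinearMap.flip_apply, LinearMap.id_apply] at h ⊢; rw [cons_mul, h]) t

lemma mul_assoc {x y z z' : X} (a : Tens V x y) (b : Tens V y z) (c : Tens V z z') :
    mul (mul a b) c = mul a (mul b c) :=
  ext (fun x => (mul (x := x)).flip c ∘ₗ (mul (x := x)).flip b)
    (fun x => (mul (x := x)).flip (mul b c)) (by simp [one_mul])
    (fun x y n v t h => by
      simp only [LinearMap.flip_apply, LinearMap.comp_apply] at h ⊢; simp only [cons_mul, h]) a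

lemma gen_mul {x y z : X} {n : ℤ} (v : V x y n) (t : Tens V y z) : mul (gen v) t = cons v t := by
  rw [gen_apply, cons_mul, one_mul]

/-- The map of tensor categories induced by a map of graded quivers. -/
def map {Y : Type u} {W : GradedQuiver K Y} (F : X → Y)
    (f : ∀ x y n, V x y n →ₗ[K] W (F x) (F y) n) {x z : X} :
    Tens V x z →ₗ[K] Tens W (F x) (F z) :=
  fold (M := fun x => Tens W (F x) (F z)) (one W (F z)) fun x y n => cons ∘ₗ f x y n

section map
variable {Y : Type u} {W : GradedQuiver K Y} (F : X → Y)
    (f : ∀ x y n, V x y n →ₗ[K] W (F x) (F y) n)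

lemma map_one (x : X) : map F f (one V x) = one W (F x) := by
  unfold map; rw [fold_one]

lemma map_cons {x y z : X} {n : ℤ} (v : V x y n) (t : Tens V y z) :
    map F f (cons v t) = cons (f x y n v) (map F f t) := by
  unfold map; rw [fold_cons]; rfl

lemma map_gen {x y : X} {n : ℤ} (v : V x y n) : map F f (gen v) = gen (f x y n v) := by
  rw [gen_apply, map_cons, map_one]; rfl

lemma map_mul {x y z : X} (a : Tens V x y) (b : Tens V y z) :
    map F f (mul a b) = mul (map F f a) (map F f b) :=
  ext (M := fun x => Tens W (F x) (F z)) (fun x => map F f ∘ₗ (mul (x := x)).flip b)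
    (fun x => (mul (x := F x)).flip (map F f b) ∘ₗ map F f)
    (by simp [one_mul, map_one])
    (fun x y n v t h => by
      simp only [LinearMap.flip_apply, LinearMap.comp_apply] at h ⊢
      simp only [cons_mul, map_cons, h]) a

end map

end Tens

end Tensor

section Decomp

variable {K : Type u} [Field K] {X : Type u}

/-- An object `mid` of `X` and two integers `p`, `q` with `p + q = n`. -/
structure Split (X : Type u) (n : ℤ) where
  mid : X
  p : ℤ
  q : ℤ
  h : p + q = n

/-- The degree `n` part of `⨁_y V(x,y) ⊗ V(y,z)`. -/
abbrev Decomp (V : GradedQuiver K X) (x z : X) (n : ℤ) : Type u :=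
  ⨁ i : Split X n, V x i.mid i.p ⊗[K] V i.mid z i.q

namespace Decomp

variable {V : GradedQuiver K X}

open Classical in
/-- `v ⊗ w` as an element of `⨁_y V(x,y) ⊗ V(y,z)`. -/
def tmul {x z : X} {n : ℤ} (y : X) (p q : ℤ) (h : p + q = n) :
    V x y p →ₗ[K] V y z q →ₗ[K] Decomp V x z n :=
  (TensorProduct.mk K _ _).compr₂
    (DirectSum.lof K (Split X n) (fun i => V x i.mid i.p ⊗[K] V i.mid z i.q) ⟨y, p, q, h⟩)

open Classical in
/-- The linear map out of `⨁_y V(x,y) ⊗ V(y,z)` defined by a family of bilinear maps. -/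
def desc {x z : X} {n : ℤ} {M : Type u} [AddCommGroup M] [Module K M]
    (f : ∀ (y : X) (p q : ℤ), p + q = n → (V x y p →ₗ[K] V y z q →ₗ[K] M)) :
    Decomp V x z n →ₗ[K] M :=
  DirectSum.toModule K _ M fun i => TensorProduct.lift (f i.mid i.p i.q i.h)

lemma desc_tmul {x z : X} {n : ℤ} {M : Type u} [AddCommGroup M] [Module K M]
    (f : ∀ (y : X) (p q : ℤ), p + q = n → (V x y p →ₗ[K] V y z q →ₗ[K] M))
    (y : X) (p q : ℤ) (h : p + q = n) (v : V x y p) (w : V y z q) :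
    desc f (tmul y p q h v w) = f y p q h v w := by
  classical
  unfold desc tmul
  simp only [LinearMap.compr₂_apply, TensorProduct.mk_apply]
  erw [DirectSum.toModule_lof]
  rfl

lemma induction {x z : X} {n : ℤ} {P : Decomp V x z n → Prop} (zero : P 0)
    (add : ∀ s t, P s → P t → P (s + t))
    (h : ∀ y p q h (v : V x y p) (w : V y z q), P (tmul y p q h v w))
    (t : Decomp V x z n) : P t := by
  classical
  induction t using DirectSum.induction_on with
  | zero => exact zero
  | add s t hs ht => exact add s t hs ht
  | of i t =>
    induction t using TensorProduct.induction_on with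
    | zero => rw [map_zero]; exact zero
    | add s t hs ht => rw [map_add]; exact add _ _ hs ht
    | tmul v w => exact h i.mid i.p i.q i.h v w

lemma ext {x z : X} {n : ℤ} {M : Type u} [AddCommGroup M] [Module K M]
    (f g : Decomp V x z n →ₗ[K] M)
    (h : ∀ y p q h (v : V x y p) (w : V y z q), f (tmul y p q h v w) = g (tmul y p q h v w))
    (t : Decomp V x z n) : f t = g t :=
  induction (P := fun t => f t = g t) (by simp) (fun s t hs ht => by simp [hs, ht]) h t

/-- The map induced by a map of graded quivers. -/
def map {Y : Type u} {W : GradedQuiver K Y} (F : X → Y)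
    (f : ∀ x y n, V x y n →ₗ[K] W (F x) (F y) n) {x z : X} {n : ℤ} :
    Decomp V x z n →ₗ[K] Decomp W (F x) (F z) n :=
  desc fun y p q h => (tmul (F y) p q h).compl₁₂ (f x y p) (f y z q)

lemma map_tmul {Y : Type u} {W : GradedQuiver K Y} (F : X → Y)
    (f : ∀ x y n, V x y n →ₗ[K] W (F x) (F y) n) {x z : X} {n : ℤ}
    (y : X) (p q : ℤ) (h : p + q = n) (v : V x y p) (w : V y z q) :
    map F f (tmul y p q h v w) = tmul (F y) p q h (f x y p v) (f y z q w) := by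
  unfold map; rw [desc_tmul]; rfl

/-- The inclusion of `⨁_y V(x,y) ⊗ V(y,z)` in the tensor category `𝕋 V`, as the words of
length two. -/
def toTens {x z : X} {n : ℤ} : Decomp V x z n →ₗ[K] Tens V x z :=
  desc fun _ _ _ _ => Tens.cons.compl₂ Tens.gen

/-- `d ⊗ Id + Id ⊗ d`, with the Koszul sign. -/
def coder (d : ∀ (x y : X) (n m : ℤ), m + 1 = n → (V x y n →ₗ[K] V x y m))
    {x z : X} {n m : ℤ} (e : m + 1 = n) : Decomp V x z n →ₗ[K] Decomp V x z m :=
  desc fun y p q h =>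
    tmul y (p - 1) q (by omega) ∘ₗ d x y p (p - 1) (by omega) +
      (-1 : K) ^ p • (tmul y p (q - 1) (by omega)).compl₂ (d y z q (q - 1) (by omega))

/-- `(θ ⊗ Id) - (Id ⊗ θ)`, where `θ` has degree `-2` and vanishes on `V(x,y)` for `x ≠ y`:
only the summands `V(x,x)_2 ⊗ V(x,z)` and `V(x,z) ⊗ V(z,z)_2` contribute. -/
def curv (θ : ∀ (x y : X) (n : ℤ), V x y n →ₗ[K] K) {x z : X} {n k : ℤ} (e : k + 2 = n)
    (t : Decomp V x z n) : V x z k :=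
  TensorProduct.lift (LinearMap.lsmul K (V x z k) ∘ₗ θ x x 2) (t ⟨x, 2, k, by omega⟩) -
    TensorProduct.lift ((LinearMap.lsmul K (V x z k)).flip.compl₂ (θ z z 2)) (t ⟨z, k, 2, e⟩)

/-- The iterated decompositions of a decomposition map `Δ`: the zeroth one is the inclusion of
the generators in `𝕋 V`, and the `(k+1)`-st one is `∑ c₁ ⊗ Δ^k c₂`, where `Δ c = ∑ c₁ ⊗ c₂`. -/
def iter (Δ : ∀ (x z : X) (n : ℤ), V x z n →ₗ[K] Decomp V x z n) :
    ℕ → ∀ (x z : X) (n : ℤ), V x z n →ₗ[K] Tens V x z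
  | 0, _, _, _ => Tens.gen
  | k + 1, x, z, n => (desc fun y _ q _ => Tens.cons.compl₂ (iter Δ k y z q)) ∘ₗ Δ x z n

end Decomp

end Decomp

/-- A curved conilpotent (non counital) cocategory over `K`, with homological grading: the
axioms read `Δ d = (d ⊗ Id + Id ⊗ d) Δ`, `d² = (θ ⊗ Id - Id ⊗ θ) Δ` and `θ d = 0`. -/
structure CurvedCocat (K : Type u) [Field K] where
  Obj : Type u
  hom : GradedQuiver K Obj
  /-- the decomposition -/
  Δ : ∀ (x z : Obj) (n : ℤ), hom x z n →ₗ[K] Decomp hom x z n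
  /-- the coderivation, of degree `-1` -/
  d : ∀ (x y : Obj) (n m : ℤ), m + 1 = n → (hom x y n →ₗ[K] hom x y m)
  /-- the curvature: a degree `-2` map `hom x x → K`, extended by zero to all `hom x y` -/
  θ : ∀ (x y : Obj) (n : ℤ), hom x y n →ₗ[K] K
  /-- `θ` is zero outside the degree `2` parts of the `hom x x` -/
  θ_eq_zero : ∀ x y n, x ≠ y ∨ n ≠ 2 → θ x y n = 0
  /-- `(Δ ⊗ Id) Δ = (Id ⊗ Δ) Δ`, in the summands of words of length three of `𝕋 hom` -/
  coassoc : ∀ (x z : Obj) (n : ℤ) (c : hom x z n),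
    Decomp.desc (fun y p _ _ =>
        Tens.mul.compl₁₂ (Decomp.toTens ∘ₗ Δ x y p) Tens.gen) (Δ x z n c) =
      Decomp.desc (fun y _ q _ =>
        Tens.cons.compl₂ (Decomp.toTens ∘ₗ Δ y z q)) (Δ x z n c)
  /-- every element is annihilated by some iterated decomposition -/
  conilpotent : ∀ (x z : Obj) (n : ℤ) (c : hom x z n), ∃ k, Decomp.iter Δ k x z n c = 0
  Δ_d : ∀ (x z : Obj) (n m : ℤ) (e : m + 1 = n) (c : hom x z n),
    Δ x z m (d x z n m e c) = Decomp.coder d e (Δ x z n c)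
  d_d : ∀ (x z : Obj) (n m k : ℤ) (e : m + 1 = n) (e' : k + 1 = m) (c : hom x z n),
    d x z m k e' (d x z n m e c) = Decomp.curv θ (by omega) (Δ x z n c)
  θ_d : ∀ (x y : Obj) (n m : ℤ) (e : m + 1 = n) (c : hom x y n), θ x y m (d x y n m e c) = 0

namespace CurvedCocat

variable {K : Type u} [Field K]

/-- A morphism of curved conilpotent cocategories: a map of graded quivers which commutes with
all the structure maps. -/
@[ext]
structure Hom (C D : CurvedCocat K) where
  obj : C.Obj → D.Obj
  map : ∀ (x y : C.Obj) (n : ℤ), C.hom x y n →ₗ[K] D.hom (obj x) (obj y) n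
  map_Δ : ∀ (x z : C.Obj) (n : ℤ) (c : C.hom x z n),
    D.Δ _ _ n (map x z n c) = Decomp.map obj map (C.Δ x z n c)
  map_d : ∀ (x y : C.Obj) (n m : ℤ) (e : m + 1 = n) (c : C.hom x y n),
    D.d _ _ n m e (map x y n c) = map x y m (C.d x y n m e c)
  map_θ : ∀ (x y : C.Obj) (n : ℤ) (c : C.hom x y n), D.θ _ _ n (map x y n c) = C.θ x y n c

instance : Category (CurvedCocat K) where
  Hom := Hom
  id C :=
    { obj := fun x => x
      map := fun _ _ _ => LinearMap.id
      map_Δ := fun x z n c =>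
        Decomp.ext LinearMap.id (Decomp.map (fun x => x) fun _ _ _ => LinearMap.id)
          (fun y p q h v w => (Decomp.map_tmul (V := C.hom) (W := C.hom) (fun x => x)
            (fun _ _ _ => LinearMap.id) y p q h v w).symm) (C.Δ x z n c)
      map_d := fun _ _ _ _ _ _ => rfl
      map_θ := fun _ _ _ _ => rfl }
  comp {C D E} f g :=
    { obj := fun x => g.obj (f.obj x)
      map := fun x y n => g.map _ _ n ∘ₗ f.map x y n
      map_Δ := fun x z n c => by
        rw [LinearMap.comp_apply, g.map_Δ, f.map_Δ]
        refine Decomp.ext (Decomp.map g.obj g.map ∘ₗ Decomp.map f.obj f.map)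
          (Decomp.map (fun x => g.obj (f.obj x)) fun x y n => g.map _ _ n ∘ₗ f.map x y n)
          (fun y p q h v w => ?_) (C.Δ x z n c)
        rw [LinearMap.comp_apply, Decomp.map_tmul, Decomp.map_tmul, Decomp.map_tmul]
        rfl
      map_d := fun x y n m e c => by
        rw [LinearMap.comp_apply, g.map_d, f.map_d]; rfl
      map_θ := fun x y n c => by
        rw [LinearMap.comp_apply, g.map_θ, f.map_θ] }
  id_comp _ := rfl
  comp_id _ := rfl
  assoc _ _ _ := rfl

end CurvedCocat
/-- A dg category over `K`: a chain complex for each pair of objects, with an associative and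
unital composition `Hom x y ⊗ Hom y z → Hom x z` of chain complexes. -/
structure DGCat (K : Type u) [Field K] where
  Obj : Type u
  Hom : Obj → Obj → ChainComplex (ModuleCat.{u} K) ℤ
  comp : ∀ {x y z : Obj} {p q n : ℤ}, p + q = n →
    ((Hom x y).X p →ₗ[K] (Hom y z).X q →ₗ[K] (Hom x z).X n)
  one : ∀ x : Obj, (Hom x x).X 0
  one_comp : ∀ {x y : Obj} {n : ℤ} (a : (Hom x y).X n), comp (zero_add n) (one x) a = a
  comp_one : ∀ {x y : Obj} {n : ℤ} (a : (Hom x y).X n), comp (add_zero n) a (one y) = a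
  assoc : ∀ {w x y z : Obj} {p q r pq qr n : ℤ} (h₁ : p + q = pq) (h₂ : q + r = qr)
    (h₃ : pq + r = n) (h₄ : p + qr = n)
    (a : (Hom w x).X p) (b : (Hom x y).X q) (c : (Hom y z).X r),
    comp h₃ (comp h₁ a b) c = comp h₄ a (comp h₂ b c)
  leibniz : ∀ {x y z : Obj} {p p' q q' n m : ℤ} (h : p + q = n) (_ : m + 1 = n)
    (h₁ : p' + q = m) (h₂ : p + q' = m) (a : (Hom x y).X p) (b : (Hom y z).X q),
    ((Hom x z).d n m).hom (comp h a b) =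
      comp h₁ (((Hom x y).d p p').hom a) b +
        (-1 : K) ^ p • comp h₂ a (((Hom y z).d q q').hom b)

namespace DGCat

variable {K : Type u} [Field K]

/-- A dg functor. -/
@[ext]
structure Functor (A B : DGCat K) where
  obj : A.Obj → B.Obj
  map : ∀ x y : A.Obj, A.Hom x y ⟶ B.Hom (obj x) (obj y)
  map_one : ∀ x, ((map x x).f 0).hom (A.one x) = B.one (obj x)
  map_comp : ∀ {x y z : A.Obj} {p q n : ℤ} (h : p + q = n)
    (a : (A.Hom x y).X p) (b : (A.Hom y z).X q),
    ((map x z).f n).hom (A.comp h a b) =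
      B.comp h (((map x y).f p).hom a) (((map y z).f q).hom b)

instance : Category (DGCat K) where
  Hom := Functor
  id A :=
    { obj := fun x => x
      map := fun _ _ => 𝟙 _
      map_one := fun _ => rfl
      map_comp := fun _ _ _ => rfl }
  comp F G :=
    { obj := fun x => G.obj (F.obj x)
      map := fun x y => F.map x y ≫ G.map _ _
      map_one := fun x => by
        rw [HomologicalComplex.comp_f, ModuleCat.hom_comp, LinearMap.comp_apply, F.map_one,
          G.map_one]
      map_comp := fun h a b => by
        simp only [HomologicalComplex.comp_f, ModuleCat.hom_comp, LinearMap.comp_apply,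
          F.map_comp, G.map_comp] }
  id_comp _ := rfl
  comp_id _ := rfl
  assoc _ _ _ := rfl

variable (A : DGCat K)

lemma d_one (x : A.Obj) : ((A.Hom x x).d 0 (-1)).hom (A.one x) = 0 := by
  have h := A.leibniz (x := x) (y := x) (z := x) (p' := -1) (q' := -1) (add_zero 0)
    (show (-1 : ℤ) + 1 = 0 by norm_num) (by norm_num) (by norm_num) (A.one x) (A.one x)
  rw [A.comp_one, A.comp_one, A.one_comp] at h
  simpa using h

/-- The cycles of degree zero. -/
def Z0 (x y : A.Obj) : Submodule K ((A.Hom x y).X 0) :=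
  LinearMap.ker ((A.Hom x y).d 0 (-1)).hom

/-- The boundaries of degree zero. -/
def B0 (x y : A.Obj) : Submodule K ((A.Hom x y).X 0) :=
  LinearMap.range ((A.Hom x y).d 1 0).hom

variable {A}

lemma comp_mem_Z0 {x y z : A.Obj} {a : (A.Hom x y).X 0} {b : (A.Hom y z).X 0}
    (ha : a ∈ A.Z0 x y) (hb : b ∈ A.Z0 y z) : A.comp (add_zero 0) a b ∈ A.Z0 x z := by
  unfold Z0 at *
  rw [LinearMap.mem_ker] at *
  rw [A.leibniz (p' := -1) (q' := -1) (add_zero 0) (by norm_num) (by norm_num) (by norm_num),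
    ha, hb]
  simp

lemma comp_mem_B0_left {x y z : A.Obj} {a : (A.Hom x y).X 0} {b : (A.Hom y z).X 0}
    (ha : a ∈ A.B0 x y) (hb : b ∈ A.Z0 y z) : A.comp (add_zero 0) a b ∈ A.B0 x z := by
  obtain ⟨c, rfl⟩ := ha
  refine ⟨A.comp (add_zero 1) c b, ?_⟩
  have hb' : ((A.Hom y z).d 0 (-1)).hom b = 0 := hb
  rw [A.leibniz (p' := 0) (q' := -1) (add_zero 1) (by norm_num) (by norm_num) (by norm_num), hb']
  simp

lemma comp_mem_B0_right {x y z : A.Obj} {a : (A.Hom x y).X 0} {b : (A.Hom y z).X 0}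
    (ha : a ∈ A.Z0 x y) (hb : b ∈ A.B0 y z) : A.comp (add_zero 0) a b ∈ A.B0 x z := by
  obtain ⟨c, rfl⟩ := hb
  refine ⟨A.comp (zero_add 1) a c, ?_⟩
  have ha' : ((A.Hom x y).d 0 (-1)).hom a = 0 := ha
  rw [A.leibniz (p' := -1) (q' := 0) (zero_add 1) (by norm_num) (by norm_num) (by norm_num), ha']
  simp

variable (A)

/-- The category `H₀(A)`: it has the objects of `A`, and its morphisms are the zeroth homology
groups of the complexes of morphisms of `A`. -/
structure H0 where
  of : A.Obj

variable {A}

/-- The morphisms of `H₀(A)`: cycles of degree zero modulo boundaries. -/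
abbrev H0.Hom (x y : H0 A) : Type u :=
  A.Z0 x.of y.of ⧸ (A.B0 x.of y.of).comap (A.Z0 x.of y.of).subtype

instance : Category (H0 A) where
  Hom := H0.Hom
  id x := Submodule.Quotient.mk ⟨A.one x.of, A.d_one x.of⟩
  comp {x y z} := Quotient.map₂
    (fun a b => ⟨A.comp (add_zero 0) a.1 b.1, comp_mem_Z0 a.2 b.2⟩) (by
      intro a a' ha b b' hb
      have ha := (Submodule.quotientRel_def _).1 ha
      have hb := (Submodule.quotientRel_def _).1 hb
      refine (Submodule.quotientRel_def _).2 ?_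
      have h : A.comp (add_zero 0) (a - a').1 b.1 + A.comp (add_zero 0) a'.1 (b - b').1 ∈
          A.B0 x.of z.of := Submodule.add_mem _ (comp_mem_B0_left ha b.2) (comp_mem_B0_right a'.2 hb)
      have e : A.comp (add_zero 0) (a - a').1 b.1 + A.comp (add_zero 0) a'.1 (b - b').1 =
          A.comp (add_zero 0) a.1 b.1 - A.comp (add_zero 0) a'.1 b'.1 := by
        simp
      rw [e] at h
      exact h)
  id_comp := by
    rintro x y ⟨a⟩
    exact congrArg Submodule.Quotient.mk (Subtype.ext (A.one_comp a.1))
  comp_id := by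
    rintro x y ⟨a⟩
    exact congrArg Submodule.Quotient.mk (Subtype.ext (A.comp_one a.1))
  assoc := by
    rintro w x y z ⟨a⟩ ⟨b⟩ ⟨c⟩
    exact congrArg Submodule.Quotient.mk (Subtype.ext (A.assoc _ _ _ _ a.1 b.1 c.1))

variable {B : DGCat K}

lemma Functor.map_mem_Z0 (F : Functor A B) {x y : A.Obj} {a : (A.Hom x y).X 0}
    (ha : a ∈ A.Z0 x y) : ((F.map x y).f 0).hom a ∈ B.Z0 (F.obj x) (F.obj y) := by
  have h := congrArg (fun g => g.hom a) ((F.map x y).comm 0 (-1))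
  have ha' : ((A.Hom x y).d 0 (-1)).hom a = 0 := ha
  simp only [ModuleCat.hom_comp, LinearMap.comp_apply, ha', map_zero] at h
  exact h

lemma Functor.map_mem_B0 (F : Functor A B) {x y : A.Obj} {a : (A.Hom x y).X 0}
    (ha : a ∈ A.B0 x y) : ((F.map x y).f 0).hom a ∈ B.B0 (F.obj x) (F.obj y) := by
  obtain ⟨c, rfl⟩ := ha
  exact ⟨((F.map x y).f 1).hom c, congrArg (fun g => g.hom c) ((F.map x y).comm 1 0)⟩

/-- The functor `H₀(F) : H₀(A) ⥤ H₀(B)`. -/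
def Functor.H0 (F : Functor A B) : DGCat.H0 A ⥤ DGCat.H0 B where
  obj x := ⟨F.obj x.of⟩
  map {x y} := Quotient.map
    (fun a => ⟨((F.map x.of y.of).f 0).hom a.1, F.map_mem_Z0 a.2⟩) (by
      intro a a' ha
      have ha := (Submodule.quotientRel_def _).1 ha
      refine (Submodule.quotientRel_def _).2 ?_
      have h : ((F.map x.of y.of).f 0).hom (a - a').1 ∈ B.B0 (F.obj x.of) (F.obj y.of) :=
        F.map_mem_B0 ha
      have e : ((F.map x.of y.of).f 0).hom (a - a').1 =
          ((F.map x.of y.of).f 0).hom a.1 - ((F.map x.of y.of).f 0).hom a'.1 := by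
        simp
      rw [e] at h
      exact h)
  map_id x := congrArg Submodule.Quotient.mk (Subtype.ext (F.map_one x.of))
  map_comp := by
    rintro x y z ⟨a⟩ ⟨b⟩
    exact congrArg Submodule.Quotient.mk (Subtype.ext (F.map_comp (add_zero 0) a.1 b.1))

/-- Quasi-equivalences of dg categories. -/
def weakEquivalences (K : Type u) [Field K] : MorphismProperty (DGCat K) := fun A _ F =>
  (∀ x y : A.Obj, QuasiIso (Functor.map F x y)) ∧ (Functor.H0 F).IsEquivalence

/-- A functor is an isofibration if every isomorphism `F x ≅ y` lifts to an isomorphism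
with source `x`. -/
def IsIsofibration {C D : Type u} [Category.{u} C] [Category.{u} D] (F : C ⥤ D) : Prop :=
  ∀ (x : C) (y : D) (e : F.obj x ≅ y), ∃ (x' : C) (f : x ≅ x') (h : F.obj x' = y),
    F.map f.hom ≫ eqToHom h = e.hom

/-- The fibrations of dg categories: the dg functors which are degreewise surjective on morphisms
and induce an isofibration on `H₀`. -/
def fibrations (K : Type u) [Field K] : MorphismProperty (DGCat K) := fun A _ F =>
  (∀ (x y : A.Obj) (n : ℤ), Function.Surjective ((Functor.map F x y).f n).hom) ∧
    IsIsofibration (Functor.H0 F)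

/-- The cofibrations of dg categories: the dg functors with the left lifting property with respect
to the fibrations which are weak equivalences. -/
def cofibrations (K : Type u) [Field K] : MorphismProperty (DGCat K) :=
  (fibrations K ⊓ weakEquivalences K).llp

end DGCat

section Cobar

variable {K : Type u} [Field K] {X : Type u} {V : GradedQuiver K X}

/-- The degree of a word in the cobar construction: a letter of degree `n` in `V` has degree
`n - 1` in the desuspension of `V`. -/
def Word.deg {z : X} : {x : X} → Word z x → ℤ
  | _, .nil => 0
  | _, .cons _ n w => (n - 1) + w.deg

namespace Tens

/-- The degree `k` part of `𝕋 (s⁻¹ V)(x,z)`. -/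
def gr (V : GradedQuiver K X) (x z : X) (k : ℤ) : Submodule K (Tens V x z) where
  carrier := {t | ∀ w, w.deg ≠ k → t w = 0}
  add_mem' := by
    intro a b ha hb w hw
    rw [DirectSum.add_apply, ha w hw, hb w hw, add_zero]
  zero_mem' := fun _ _ => rfl
  smul_mem' := by
    intro c a ha w hw
    rw [DirectSum.smul_apply, ha w hw, smul_zero]

lemma incl_mem_gr {x z : X} (w : Word z x) (t : w.tensor V) : incl V w t ∈ gr V x z w.deg := by
  classical
  intro w' hw'
  have h : w ≠ w' := fun h => hw' (h ▸ rfl)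
  exact DirectSum.of_eq_of_ne _ _ _ h.symm

lemma gr_induction {x z : X} {k : ℤ} {P : Tens V x z → Prop} (t : Tens V x z)
    (ht : t ∈ gr V x z k) (zero : P 0) (add : ∀ s t, P s → P t → P (s + t))
    (h : ∀ (w : Word z x) (t : w.tensor V), w.deg = k → P (incl V w t)) : P t := by
  refine sum_induction t zero add fun w => ?_
  by_cases hw : w.deg = k
  · exact h w _ hw
  · rw [ht w hw, map_zero]; exact zero

lemma one_mem_gr (x : X) : one V x ∈ gr V x x 0 :=
  incl_mem_gr (V := V) (Word.nil : Word x x) (1 : K)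

lemma unit_mem_gr (x z : X) : unit V x z ∈ gr V x z 0 := by
  unfold unit
  split_ifs with h
  · subst h; exact one_mem_gr x
  · exact zero_mem _

lemma cons_mem_gr {x y z : X} {n k m : ℤ} (h : n - 1 + k = m) (v : V x y n) {t : Tens V y z}
    (ht : t ∈ gr V y z k) : cons v t ∈ gr V x z m := by
  refine gr_induction (P := fun t => cons v t ∈ gr V x z m) t ht (by rw [map_zero]; exact zero_mem _)
    (fun s t hs ht => by rw [map_add]; exact add_mem hs ht) fun w t hw => ?_
  rw [cons_incl]
  have h' : (Word.cons x n w).deg = m := by simp only [Word.deg]; omega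
  exact h' ▸ incl_mem_gr (Word.cons x n w) _

lemma gen_mem_gr {x y : X} {n m : ℤ} (h : n - 1 = m) (v : V x y n) : gen v ∈ gr V x y m :=
  cons_mem_gr (by omega) v (one_mem_gr y)

lemma mul_mem_gr {x y z : X} {p q n : ℤ} (h : p + q = n) {a : Tens V x y} {b : Tens V y z}
    (ha : a ∈ gr V x y p) (hb : b ∈ gr V y z q) : mul a b ∈ gr V x z n := by
  have key : ∀ (w : Word y x) (t : w.tensor V), mul (incl V w t) b ∈ gr V x z (w.deg + q) :=
    fun w t => incl_induction (P := fun x w t => mul t b ∈ gr V x z (w.deg + q))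
      (fun x w => by rw [map_zero]; exact zero_mem _)
      (fun x w s t hs ht => by rw [map_add]; exact add_mem hs ht)
      (fun c => by
        rw [map_smul, LinearMap.smul_apply, one_mul]
        exact Submodule.smul_mem _ _ (by simpa only [Word.deg, zero_add] using hb))
      (fun x y n v w t ht => by
        rw [cons_mul]
        exact cons_mem_gr (by simp only [Word.deg]; omega) v ht) w t
  refine gr_induction (P := fun a => mul a b ∈ gr V x z n) a ha (by rw [map_zero]; exact zero_mem _)
    (fun s t hs ht => by rw [map_add]; exact add_mem hs ht) fun w t hw => ?_
  have := key w t
  rwa [show w.deg + q = n by omega] at this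

lemma map_mem_gr {Y : Type u} {W : GradedQuiver K Y} (F : X → Y)
    (f : ∀ x y n, V x y n →ₗ[K] W (F x) (F y) n) {x z : X} {k : ℤ} {t : Tens V x z}
    (ht : t ∈ gr V x z k) : map F f t ∈ gr W (F x) (F z) k := by
  have key : ∀ (w : Word z x) (t : w.tensor V), map F f (incl V w t) ∈ gr W (F x) (F z) w.deg :=
    fun w t => incl_induction (P := fun x w t => map F f t ∈ gr W (F x) (F z) w.deg)
      (fun x w => by rw [map_zero]; exact zero_mem _)
      (fun x w s t hs ht => by rw [map_add]; exact add_mem hs ht)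
      (fun c => by
        rw [map_smul, map_one]
        exact Submodule.smul_mem _ _ (one_mem_gr _))
      (fun x y n v w t ht => by
        rw [map_cons]
        exact cons_mem_gr rfl _ ht) w t
  refine gr_induction (P := fun t => map F f t ∈ gr W (F x) (F z) k) t ht
    (by rw [map_zero]; exact zero_mem _)
    (fun s t hs ht => by rw [map_add]; exact add_mem hs ht) fun w t hw => hw ▸ key w t

/-- The degree `-1` derivation `D` of `𝕋 (s⁻¹ V)` extending a map `δ` on generators: on words,
`D (v ⊗ t) = δ v · t + (-1)^(|v|-1) v ⊗ D t`. -/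
def derWord (δ : ∀ (x y : X) (n : ℤ), V x y n →ₗ[K] Tens V x y) {z : X} :
    {x : X} → (w : Word z x) → w.tensor V →ₗ[K] Tens V x z
  | _, .nil => 0
  | _, @Word.cons _ _ x y n w =>
      TensorProduct.lift (mul.compl₁₂ (δ x y n) (incl V w) +
        (-1 : K) ^ (n - 1) • cons.compl₂ (derWord δ w))

/-- The degree `-1` derivation of `𝕋 (s⁻¹ V)` extending a map `δ` on generators. -/
def der (δ : ∀ (x y : X) (n : ℤ), V x y n →ₗ[K] Tens V x y) {x z : X} :
    Tens V x z →ₗ[K] Tens V x z :=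
  desc (derWord δ)

section der

variable (δ : ∀ (x y : X) (n : ℤ), V x y n →ₗ[K] Tens V x y)

lemma der_one (x : X) : der δ (one V x) = 0 :=
  (desc_incl (derWord δ (z := x)) (Word.nil : Word x x) (1 : K)).trans rfl

lemma der_unit (x z : X) : der δ (unit V x z) = 0 := by
  unfold unit
  split_ifs with h
  · subst h; exact der_one δ x
  · exact map_zero _

lemma der_cons {x y z : X} {n : ℤ} (v : V x y n) (t : Tens V y z) :
    der δ (cons v t) = mul (δ x y n v) t + (-1 : K) ^ (n - 1) • cons v (der δ t) := by
  refine sum_induction (P := fun t => der δ (cons v t) =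
      mul (δ x y n v) t + (-1 : K) ^ (n - 1) • cons v (der δ t)) t
    (by simp only [map_zero, smul_zero, add_zero])
    (fun s t hs ht => by simp only [map_add, hs, ht, smul_add]; abel) fun w => ?_
  unfold der
  rw [cons_incl, desc_incl (derWord δ) w]
  exact (desc_incl (derWord δ) (Word.cons x n w) _).trans rfl

lemma der_gen {x y : X} {n : ℤ} (v : V x y n) : der δ (gen v) = δ x y n v := by
  rw [gen_apply, der_cons, der_one, map_zero, smul_zero, add_zero, mul_one]

lemma sign_mul (p q : ℤ) : (-1 : K) ^ p * (-1 : K) ^ q = (-1 : K) ^ (p + q) :=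
  (zpow_add₀ (by simp) p q).symm

lemma sign_sub_one (p : ℤ) : (-1 : K) ^ (p - 1) = - (-1 : K) ^ p := by
  rw [zpow_sub_one₀ (by simp)]; simp

lemma sign_sq (p : ℤ) : (-1 : K) ^ p * (-1 : K) ^ p = 1 := by
  rw [← mul_zpow]; simp

lemma der_mul {x y z : X} {k : ℤ} {a : Tens V x y} (ha : a ∈ gr V x y k) (b : Tens V y z) :
    der δ (mul a b) = mul (der δ a) b + (-1 : K) ^ k • mul a (der δ b) := by
  have key : ∀ (w : Word y x) (t : w.tensor V), der δ (mul (incl V w t) b) =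
      mul (der δ (incl V w t)) b + (-1 : K) ^ w.deg • mul (incl V w t) (der δ b) :=
    fun w t => incl_induction (P := fun x w t => der δ (mul t b) =
      mul (der δ t) b + (-1 : K) ^ w.deg • mul t (der δ b))
      (fun x w => by simp)
      (fun x w s t hs ht => by
        simp only [map_add, LinearMap.add_apply, hs, ht, smul_add]; abel)
      (fun c => by
        simp only [map_smul, LinearMap.smul_apply, one_mul, der_one, smul_zero, map_zero,
          LinearMap.zero_apply, zero_add, Word.deg, zpow_zero, one_smul])
      (fun x y n v w t ht => by
        simp only [cons_mul, der_cons, ht, map_add, map_smul, LinearMap.add_apply,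
          LinearMap.smul_apply, mul_assoc, smul_add, smul_smul, sign_mul, Word.deg, add_assoc]) w t
  refine gr_induction (P := fun a => der δ (mul a b) =
      mul (der δ a) b + (-1 : K) ^ k • mul a (der δ b)) a ha (by simp)
    (fun s t hs ht => by simp only [map_add, LinearMap.add_apply, hs, ht, smul_add]; abel)
    fun w t hw => hw ▸ key w t

lemma der_mem_gr (hδ : ∀ x y n (v : V x y n), δ x y n v ∈ gr V x y (n - 2)) {x z : X} {k m : ℤ}
    (h : m + 1 = k) {t : Tens V x z} (ht : t ∈ gr V x z k) : der δ t ∈ gr V x z m := by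
  have key : ∀ (w : Word z x) (t : w.tensor V), der δ (incl V w t) ∈ gr V x z (w.deg - 1) ∧
      incl V w t ∈ gr V x z w.deg :=
    fun w t => incl_induction (P := fun x w t => der δ t ∈ gr V x z (w.deg - 1) ∧
        t ∈ gr V x z w.deg)
      (fun x w => by rw [map_zero]; exact ⟨zero_mem _, zero_mem _⟩)
      (fun x w s t hs ht => by rw [map_add]; exact ⟨add_mem hs.1 ht.1, add_mem hs.2 ht.2⟩)
      (fun c => by
        rw [map_smul, der_one, smul_zero]
        exact ⟨zero_mem _, Submodule.smul_mem _ _ (one_mem_gr _)⟩)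
      (fun x y n v w t ht => by
        rw [der_cons]
        exact ⟨add_mem (mul_mem_gr (by simp only [Word.deg]; omega) (hδ _ _ _ v) ht.2)
          (Submodule.smul_mem _ _ (cons_mem_gr (by simp only [Word.deg]; omega) v ht.1)),
          cons_mem_gr rfl v ht.2⟩) w t
  refine gr_induction (P := fun t => der δ t ∈ gr V x z m) t ht
    (by rw [map_zero]; exact zero_mem _)
    (fun s t hs ht => by rw [map_add]; exact add_mem hs ht) fun w t hw => ?_
  have := (key w t).1
  rwa [show w.deg - 1 = m by omega] at this

lemma der_der (hδ : ∀ x y n (v : V x y n), δ x y n v ∈ gr V x y (n - 2))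
    (h : ∀ x y n (v : V x y n), der δ (δ x y n v) = 0) {x z : X} (t : Tens V x z) :
    der δ (der δ t) = 0 := by
  refine induction (P := fun x t => der δ (der δ t) = 0) (by simp)
    (fun x s t hs ht => by simp only [map_add, hs, ht, add_zero]) (fun c => by simp [der_one])
    (fun x y n v t ht => ?_) t
  rw [der_cons, map_add, der_mul δ (hδ x y n v), h, map_smul, der_cons, ht,
    show n - 2 = n - 1 - 1 by ring, sign_sub_one (n - 1)]
  simp

lemma map_der {Y : Type u} {W : GradedQuiver K Y} (F : X → Y)
    (f : ∀ x y n, V x y n →ₗ[K] W (F x) (F y) n)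
    (ε : ∀ (x y : Y) (n : ℤ), W x y n →ₗ[K] Tens W x y)
    (h : ∀ x y n (v : V x y n), map F f (δ x y n v) = ε _ _ n (f x y n v)) {x z : X}
    (t : Tens V x z) : map F f (der δ t) = der ε (map F f t) := by
  refine induction (P := fun x t => map F f (der δ t) = der ε (map F f t)) (by simp)
    (fun x s t hs ht => by simp only [map_add, hs, ht]) (fun c => by simp [der_one, map_one])
    (fun x y n v t ht => ?_) t
  rw [der_cons, map_add, map_mul, map_smul, map_cons, map_cons, der_cons, h, ht]

end der

end Tens

namespace CurvedCocat

open Tens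

/-- The map `v ⊗ w ↦ (-1)^|v| v ⊗ w` from `⨁_y V(x,y) ⊗ V(y,z)` to `𝕋 V`. -/
def signTens {X : Type u} {V : GradedQuiver K X} {x z : X} {n : ℤ} :
    Decomp V x z n →ₗ[K] Tens V x z :=
  Decomp.desc fun _ p _ _ => (-1 : K) ^ p • cons.compl₂ gen

lemma signTens_tmul {X : Type u} {V : GradedQuiver K X} {x y z : X} {n p q : ℤ} (h : p + q = n)
    (v : V x y p) (w : V y z q) :
    signTens (Decomp.tmul y p q h v w) = (-1 : K) ^ p • cons v (gen w) :=
  Decomp.desc_tmul _ _ _ _ _ _ _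

/-- The differential of the cobar construction on generators:
`s⁻¹ c ↦ θ(c) 1 - s⁻¹ d c - ∑ (-1)^|c₁| s⁻¹ c₁ ⊗ s⁻¹ c₂`, where `Δ c = ∑ c₁ ⊗ c₂`. -/
def cobarGen (C : CurvedCocat K) (x z : C.Obj) (n : ℤ) : C.hom x z n →ₗ[K] Tens C.hom x z :=
  (C.θ x z n).smulRight (unit C.hom x z) - gen ∘ₗ C.d x z n (n - 1) (by omega) -
    signTens ∘ₗ C.Δ x z n

variable (C : CurvedCocat K)

lemma cobarGen_apply (x z : C.Obj) (n : ℤ) (c : C.hom x z n) :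
    C.cobarGen x z n c = C.θ x z n c • unit C.hom x z - gen (C.d x z n (n - 1) (by omega) c) -
      signTens (C.Δ x z n c) := rfl

lemma cobarGen_mem_gr (x z : C.Obj) (n : ℤ) (c : C.hom x z n) :
    C.cobarGen x z n c ∈ gr C.hom x z (n - 2) := by
  rw [cobarGen_apply]
  refine sub_mem (sub_mem ?_ (gen_mem_gr (by omega) _)) ?_
  · by_cases hn : n = 2
    · subst hn
      exact Submodule.smul_mem _ _ ((show (0 : ℤ) = 2 - 2 from rfl) ▸ unit_mem_gr x z)
    · rw [C.θ_eq_zero x z n (Or.inr hn), LinearMap.zero_apply, zero_smul]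
      exact zero_mem _
  · refine Decomp.induction (P := fun t => signTens t ∈ gr C.hom x z (n - 2))
      (by rw [map_zero]; exact zero_mem _)
      (fun s t hs ht => by rw [map_add]; exact add_mem hs ht) (fun y p q h v w => ?_) _
    rw [signTens_tmul]
    exact Submodule.smul_mem _ _
      (cons_mem_gr (k := q - 1) (by omega) v (gen_mem_gr rfl w))

lemma curv_tmul {X : Type u} {V : GradedQuiver K X} (θ : ∀ (x y : X) (n : ℤ), V x y n →ₗ[K] K)
    (hθ : ∀ x y n, x ≠ y ∨ n ≠ 2 → θ x y n = 0) {x z y : X} {n k p q : ℤ} (e : k + 2 = n)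
    (h : p + q = n) (v : V x y p) (w : V y z q) :
    gen (Decomp.curv θ e (Decomp.tmul y p q h v w)) =
      θ x y p v • mul (unit V x y) (gen w) - θ y z q w • mul (gen v) (unit V y z) := by
  classical
  unfold Decomp.curv
  rw [map_sub]
  congr 1
  · by_cases hy : x = y ∧ p = 2
    · obtain ⟨rfl, rfl⟩ := hy
      obtain rfl : k = q := by omega
      rw [show unit V x x = one V x by simp [unit], Tens.one_mul, ← map_smul]
      congr 1
      unfold Decomp.tmul
      rw [LinearMap.compr₂_apply, DirectSum.lof_apply]
      rfl
    · rw [hθ x y p (by tauto), LinearMap.zero_apply, zero_smul]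
      unfold Decomp.tmul
      rw [LinearMap.compr₂_apply, DirectSum.lof_eq_of, DirectSum.of_eq_of_ne, map_zero, map_zero]
      intro h'
      injection h' with h₁ h₂ h₃
      exact hy ⟨h₁, h₂.symm⟩
  · by_cases hy : y = z ∧ q = 2
    · obtain ⟨rfl, rfl⟩ := hy
      obtain rfl : k = p := by omega
      rw [show unit V y y = one V y by simp [unit], Tens.mul_one, ← map_smul]
      congr 1
      unfold Decomp.tmul
      rw [LinearMap.compr₂_apply, DirectSum.lof_apply]
      rfl
    · rw [hθ y z q (by tauto), LinearMap.zero_apply, zero_smul]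
      unfold Decomp.tmul
      rw [LinearMap.compr₂_apply, DirectSum.lof_eq_of, DirectSum.of_eq_of_ne, map_zero, map_zero]
      intro h'
      injection h' with h₁ h₂ h₃
      exact hy ⟨h₁.symm, h₃.symm⟩


/-- The degree of the second letter of a word. -/
def sndDeg {X : Type u} {z : X} : {x : X} → Word z x → ℤ
  | _, .cons _ _ (.cons _ n _) => n
  | _, _ => 0

/-- The automorphism of `𝕋 V` which multiplies a word by the sign of its second letter. -/
def sndSign {X : Type u} {V : GradedQuiver K X} {x z : X} : Tens V x z →ₗ[K] Tens V x z :=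
  Tens.desc fun w => (-1 : K) ^ sndDeg w • Tens.incl V w

lemma sndSign_cons_cons {X : Type u} {V : GradedQuiver K X} {x y y' z : X} {n n' : ℤ}
    (v : V x y n) (v' : V y y' n') (t : Tens V y' z) :
    sndSign (cons v (cons v' t)) = (-1 : K) ^ n' • cons v (cons v' t) := by
  refine Tens.sum_induction (P := fun t => sndSign (cons v (cons v' t)) =
      (-1 : K) ^ n' • cons v (cons v' t)) t
    (by simp only [map_zero, smul_zero])
    (fun s t hs ht => by simp only [map_add, hs, ht, smul_add]) fun w => ?_
  have e : cons v (cons v' (incl V w (t w))) = incl V (Word.cons x n (Word.cons y n' w))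
      (v ⊗ₜ[K] (v' ⊗ₜ[K] t w : V y y' n' ⊗[K] w.tensor V) :
        V x y n ⊗[K] (Word.cons y n' w).tensor V) :=
    (congrArg (cons v) (cons_incl v' w (t w))).trans (cons_incl v (Word.cons y n' w) _)
  rw [e]
  exact (Tens.desc_incl _ _ _).trans rfl

lemma toTens_tmul {X : Type u} {V : GradedQuiver K X} {x y z : X} {n p q : ℤ} (h : p + q = n)
    (v : V x y p) (w : V y z q) :
    Decomp.toTens (Decomp.tmul y p q h v w) = cons v (gen w) :=
  Decomp.desc_tmul _ _ _ _ _ _ _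

lemma coder_tmul {X : Type u} {V : GradedQuiver K X}
    (d : ∀ (x y : X) (n m : ℤ), m + 1 = n → (V x y n →ₗ[K] V x y m))
    {x y z : X} {n m : ℤ} (e : m + 1 = n) {p q : ℤ} (h : p + q = n)
    (v : V x y p) (w : V y z q) :
    Decomp.coder d e (Decomp.tmul y p q h v w) =
      Decomp.tmul y (p - 1) q (by omega) (d x y p (p - 1) (by omega) v) w +
      (-1 : K) ^ p • Decomp.tmul y p (q - 1) (by omega) v (d y z q (q - 1) (by omega) w) :=
  Decomp.desc_tmul _ _ _ _ _ _ _

lemma sndSign_left {X : Type u} {V : GradedQuiver K X} {x y z : X} {p q : ℤ}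
    (s : Decomp V x y p) (w : V y z q) :
    sndSign (mul (Decomp.toTens s) (gen w)) = (-1 : K) ^ p • mul (signTens s) (gen w) := by
  refine Decomp.induction (P := fun s => sndSign (mul (Decomp.toTens s) (gen w)) =
      (-1 : K) ^ p • mul (signTens s) (gen w)) (by simp only [map_zero, LinearMap.zero_apply,
        smul_zero])
    (fun s t hs ht => by simp only [map_add, LinearMap.add_apply, hs, ht, smul_add])
    (fun y' a b h v v' => ?_) s
  rw [toTens_tmul, signTens_tmul, cons_mul, gen_mul, sndSign_cons_cons, map_smul,
    LinearMap.smul_apply, cons_mul, gen_mul, smul_smul, ← h, ← sign_mul (K := K) a b,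
    mul_comm ((-1 : K) ^ a), _root_.mul_assoc, sign_sq, _root_.mul_one]

lemma sndSign_right {X : Type u} {V : GradedQuiver K X} {x y z : X} {p q : ℤ}
    (v : V x y p) (s : Decomp V y z q) :
    sndSign (cons v (Decomp.toTens s)) = cons v (signTens s) := by
  refine Decomp.induction (P := fun s => sndSign (cons v (Decomp.toTens s)) =
      cons v (signTens s)) (by simp only [map_zero])
    (fun s t hs ht => by simp only [map_add, hs, ht])
    (fun y' a b h w w' => ?_) s
  rw [toTens_tmul, signTens_tmul, sndSign_cons_cons, map_smul]

/-- The defect of coassociativity, with the signs of the cobar construction. -/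
def assocDefect (x z : C.Obj) (n : ℤ) : Decomp C.hom x z n →ₗ[K] Tens C.hom x z :=
  Decomp.desc fun y p q _ =>
    cons.compl₂ (signTens ∘ₗ C.Δ y z q) -
      (-1 : K) ^ p • mul.compl₁₂ (signTens ∘ₗ C.Δ x y p) gen

lemma assocDefect_Δ (x z : C.Obj) (n : ℤ) (c : C.hom x z n) :
    C.assocDefect x z n (C.Δ x z n c) = 0 := by
  have h := congrArg sndSign (C.coassoc x z n c)
  have key : ∀ t : Decomp C.hom x z n, C.assocDefect x z n t =
      sndSign (Decomp.desc (fun y _ q _ =>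
        cons.compl₂ (Decomp.toTens ∘ₗ C.Δ y z q)) t) -
      sndSign (Decomp.desc (fun y p _ _ =>
        mul.compl₁₂ (Decomp.toTens ∘ₗ C.Δ x y p) gen) t) := by
    intro t
    refine Decomp.ext (C.assocDefect x z n)
      (sndSign ∘ₗ Decomp.desc (fun y _ q _ =>
        cons.compl₂ (Decomp.toTens ∘ₗ C.Δ y z q)) -
      sndSign ∘ₗ Decomp.desc (fun y p _ _ =>
        mul.compl₁₂ (Decomp.toTens ∘ₗ C.Δ x y p) gen)) (fun y p q h v w => ?_) t
    rw [LinearMap.sub_apply, LinearMap.comp_apply, LinearMap.comp_apply, assocDefect,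
      Decomp.desc_tmul, Decomp.desc_tmul, Decomp.desc_tmul]
    simp only [LinearMap.sub_apply, LinearMap.smul_apply, LinearMap.compl₁₂_apply,
      LinearMap.compl₂_apply, LinearMap.comp_apply, sndSign_left, sndSign_right]
  rw [key, h, sub_self]

lemma θ_sign (x y : C.Obj) (p : ℤ) (v : C.hom x y p) :
    (-1 : K) ^ p * C.θ x y p v = C.θ x y p v := by
  by_cases hp : p = 2
  · subst hp; norm_num
  · rw [C.θ_eq_zero x y p (Or.inr hp)]; simp

lemma der_signTens {x z : C.Obj} {n m k : ℤ} (e : m + 1 = n) (e' : k + 2 = n)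
    (t : Decomp C.hom x z n) :
    der C.cobarGen (signTens t) = gen (Decomp.curv C.θ e' t) +
      signTens (Decomp.coder C.d e t) + C.assocDefect x z n t := by
  have hcurv : ∀ s t : Decomp C.hom x z n,
      Decomp.curv C.θ e' (s + t) = Decomp.curv C.θ e' s + Decomp.curv C.θ e' t := by
    intro s t
    simp only [Decomp.curv, DirectSum.add_apply, map_add]
    abel
  have hcurv0 : Decomp.curv C.θ e' (0 : Decomp C.hom x z n) = 0 := by
    simp only [Decomp.curv, DirectSum.zero_apply, map_zero, sub_self]
  refine Decomp.induction (P := fun t => der C.cobarGen (signTens t) =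
      gen (Decomp.curv C.θ e' t) + signTens (Decomp.coder C.d e t) + C.assocDefect x z n t)
    (by simp only [map_zero, hcurv0, add_zero])
    (fun s t hs ht => by simp only [map_add, hs, ht, hcurv]; abel)
    (fun y p q h v w => ?_) t
  rw [signTens_tmul, map_smul, der_cons, der_gen, curv_tmul C.θ C.θ_eq_zero e' h, coder_tmul,
    map_add, map_smul, signTens_tmul, signTens_tmul, assocDefect, Decomp.desc_tmul,
    cobarGen_apply, cobarGen_apply]
  have hs : ∀ a : K, (-1 : K) ^ p * ((-1 : K) ^ p * a) = a := fun a => by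
    rw [← _root_.mul_assoc, sign_sq, _root_.one_mul]
  simp only [map_sub, map_smul, LinearMap.sub_apply, LinearMap.smul_apply, gen_mul,
    LinearMap.compl₁₂_apply, LinearMap.compl₂_apply, LinearMap.comp_apply, smul_add, smul_sub,
    smul_smul, sign_sq, one_smul, sign_sub_one, neg_mul, neg_smul, smul_neg, θ_sign, hs]
  abel

lemma der_cobarGen (x z : C.Obj) (n : ℤ) (c : C.hom x z n) :
    der C.cobarGen (C.cobarGen x z n c) = 0 := by
  rw [cobarGen_apply, map_sub, map_sub, map_smul, der_unit, der_gen, cobarGen_apply, C.θ_d,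
    C.d_d x z n (n - 1) (n - 1 - 1), C.Δ_d,
    C.der_signTens (m := n - 1) (k := n - 1 - 1) (by omega) (by omega), assocDefect_Δ, zero_smul, smul_zero]
  abel


/-- The complexes of morphisms of the cobar construction. -/
def cobarHom (x z : C.Obj) : ChainComplex (ModuleCat.{u} K) ℤ where
  X k := ModuleCat.of K (gr C.hom x z k)
  d i j := open Classical in
    if h : j + 1 = i then
      ModuleCat.ofHom ((der C.cobarGen).restrict
        fun _ ht => der_mem_gr C.cobarGen C.cobarGen_mem_gr h ht)
    else 0
  shape i j h := dif_neg h
  d_comp_d' i j k hij hjk := by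
    rw [dif_pos (show j + 1 = i from hij), dif_pos (show k + 1 = j from hjk)]
    refine ModuleCat.hom_ext (LinearMap.ext fun t => Subtype.ext ?_)
    exact (der_der C.cobarGen C.cobarGen_mem_gr C.der_cobarGen t.1)

lemma cobarHom_d {x z : C.Obj} {i j : ℤ} (h : j + 1 = i) (t : (C.cobarHom x z).X i) :
    (((C.cobarHom x z).d i j).hom t).1 = der C.cobarGen t.1 := by
  unfold cobarHom
  simp only [dif_pos h]
  rfl

/-- The cobar construction `Ω_u C = 𝕋 (s⁻¹ C)`. -/
def cobar : DGCat K where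
  Obj := C.Obj
  Hom := C.cobarHom
  comp {x y z p q n} h := LinearMap.mk₂ K
    (fun a b => (⟨mul a.1 b.1, mul_mem_gr h a.2 b.2⟩ : gr C.hom x z n))
    (fun a a' b => Subtype.ext (LinearMap.map_add₂ mul a.1 a'.1 b.1))
    (fun c a b => Subtype.ext (LinearMap.map_smul₂ mul c a.1 b.1))
    (fun a b b' => Subtype.ext (map_add (mul a.1) b.1 b'.1))
    (fun c a b => Subtype.ext (map_smul (mul a.1) c b.1))
  one x := (⟨one C.hom x, one_mem_gr x⟩ : gr C.hom x x 0)
  one_comp a := Subtype.ext (Tens.one_mul a.1)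
  comp_one a := Subtype.ext (Tens.mul_one a.1)
  assoc _ _ _ _ a b c := Subtype.ext (Tens.mul_assoc a.1 b.1 c.1)
  leibniz {x y z p p' q q' n m} h e h₁ h₂ a b := by
    refine Subtype.ext ((C.cobarHom_d e _).trans ((der_mul C.cobarGen a.2 b.1).trans ?_))
    rw [← C.cobarHom_d (j := p') (by omega) a, ← C.cobarHom_d (j := q') (by omega) b]
    rfl

variable {C} {D : CurvedCocat K}

lemma map_cobarGen (f : C ⟶ D) (x z : C.Obj) (n : ℤ) (c : C.hom x z n) :
    Tens.map (Hom.obj f) (Hom.map f) (C.cobarGen x z n c) =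
      D.cobarGen _ _ n (Hom.map f x z n c) := by
  have hu : C.θ x z n c • Tens.map (Hom.obj f) (Hom.map f) (unit C.hom x z) =
      C.θ x z n c • unit D.hom (Hom.obj f x) (Hom.obj f z) := by
    by_cases h : x = z
    · subst h
      simp [unit, Tens.map_one]
    · rw [C.θ_eq_zero x z n (Or.inl h)]; simp
  have hs : ∀ t : Decomp C.hom x z n, Tens.map (Hom.obj f) (Hom.map f) (signTens t) =
      signTens (Decomp.map (Hom.obj f) (Hom.map f) t) := by
    intro t
    refine Decomp.ext (Tens.map (Hom.obj f) (Hom.map f) ∘ₗ signTens)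
      (signTens ∘ₗ Decomp.map (Hom.obj f) (Hom.map f)) (fun y p q h v w => ?_) t
    rw [LinearMap.comp_apply, LinearMap.comp_apply, signTens_tmul, Decomp.map_tmul,
      signTens_tmul, map_smul, map_cons, map_gen]
  rw [cobarGen_apply, cobarGen_apply, map_sub, map_sub, map_smul, hu, Hom.map_θ, map_gen,
    Hom.map_d, hs, Hom.map_Δ]

lemma tens_map_id (x z : C.Obj) (t : Tens C.hom x z) :
    Tens.map (Hom.obj (𝟙 C)) (Hom.map (𝟙 C)) t = t :=
  Tens.ext (M := fun x => Tens C.hom x z)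
    (fun x => Tens.map (Hom.obj (𝟙 C)) (Hom.map (𝟙 C)) (x := x)) (fun _ => LinearMap.id)
    (Tens.map_one (V := C.hom) (W := C.hom) (Hom.obj (𝟙 C)) (Hom.map (𝟙 C)) z)
    (fun _ _ _ v t h => (Tens.map_cons (V := C.hom) (W := C.hom) (Hom.obj (𝟙 C)) (Hom.map (𝟙 C))
      v t).trans (congrArg (cons v) h)) t

lemma tens_map_comp {E : CurvedCocat K} (f : C ⟶ D) (g : D ⟶ E) (x z : C.Obj)
    (t : Tens C.hom x z) :
    Tens.map (Hom.obj (f ≫ g)) (Hom.map (f ≫ g)) t =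
      Tens.map (Hom.obj g) (Hom.map g) (Tens.map (Hom.obj f) (Hom.map f) t) :=
  Tens.ext (M := fun x => Tens E.hom (Hom.obj (f ≫ g) x) (Hom.obj (f ≫ g) z))
    (fun x => Tens.map (Hom.obj (f ≫ g)) (Hom.map (f ≫ g)) (x := x))
    (fun x => Tens.map (Hom.obj g) (Hom.map g) ∘ₗ Tens.map (Hom.obj f) (Hom.map f) (x := x))
    (by
      rw [LinearMap.comp_apply, Tens.map_one, Tens.map_one, Tens.map_one]; rfl)
    (fun _ _ _ v t h => by
      rw [LinearMap.comp_apply] at h ⊢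
      rw [Tens.map_cons, Tens.map_cons, Tens.map_cons, h]; rfl) t

/-- The cobar construction on morphisms. -/
def cobarMap (f : C ⟶ D) : C.cobar ⟶ D.cobar :=
  show DGCat.Functor _ _ from
  { obj := Hom.obj f
    map := fun x z =>
      { f := fun k => ModuleCat.ofHom (X := gr C.hom x z k) (Y := gr D.hom _ _ k)
          ((Tens.map (Hom.obj f) (Hom.map f)).restrict fun _ ht => map_mem_gr _ _ ht)
        comm' := fun i j h => by
          ext t
          refine Subtype.ext ((D.cobarHom_d h _).trans ?_)
          refine (Tens.map_der C.cobarGen _ _ D.cobarGen (map_cobarGen f) t.1).symm.trans ?_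
          rw [← C.cobarHom_d h t]
          rfl }
    map_one := fun x => Subtype.ext (Tens.map_one _ _ x)
    map_comp := fun h a b => Subtype.ext (Tens.map_mul _ _ a.1 b.1) }

/-- The cobar functor `Ω_u` from curved conilpotent cocategories to dg categories. -/
def cobarFunctor (K : Type u) [Field K] : CurvedCocat K ⥤ DGCat K where
  obj C := C.cobar
  map f := cobarMap f
  map_id C := by
    refine DGCat.Functor.ext rfl (heq_of_eq ?_)
    funext x z
    ext k t
    exact Subtype.ext (tens_map_id x z t.1)
  map_comp f g := by
    refine DGCat.Functor.ext rfl (heq_of_eq ?_)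
    funext x z
    ext k t
    exact Subtype.ext (tens_map_comp f g x z t.1)

end CurvedCocat
end Cobar
end
end CobarCat

/-!
No such model structure exists because the fold map `{0, 1} → {0}` of discrete cocategories (all
modules of morphisms zero) has no factorization as a cofibration followed by a weak equivalence.

Suppose it factors as `{0, 1} → J → {0}`.

* The image of a cofibration under `Ω_u` has the left lifting property with respect to
  `indiscrete S → indiscrete {0}`, where `indiscrete S` is the dg category with set of objects `S`
  and zero complexes of morphisms. Hence cofibrations are injective on objects
  (`DGCat.obj_injective_of_cofibrations`), and `0`, `1` have distinct images `x`, `y` in `J`.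
* As `Ω_u J → Ω_u {0}` is a quasi-equivalence and its target has a single object, `x` and `y` are
  isomorphic in `H₀(Ω_u J)`.
* Morphisms of curved cocategories preserve the curvature strictly, so the existence of `J → {0}`
  forces the curvature of `J` to vanish. Then the differential of `Ω_u J` never hits the unit:
  the augmentation `Tens.aug`, which reads off the coefficient of the empty word, is
  multiplicative, kills boundaries, and vanishes on morphisms between distinct objects. Applied to
  a composite `x → y → x` homologous to the identity it gives `0 = 1`
  (`CurvedCocat.eq_of_iso_of_θ_eq_zero`).
-/

namespace CobarCat

open scoped TensorProduct DirectSum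
open HomotopicalAlgebra

noncomputable section

namespace Tens

variable {K : Type u} [Field K] {X : Type u} {V : GradedQuiver K X}

/-- The augmentation of `𝕋 V`: the coefficient of the empty word, which is zero on `(𝕋 V)(x,z)`
for `x ≠ z`. -/
def aug {x z : X} : Tens V x z →ₗ[K] K :=
  fold (M := fun _ => K) (1 : K) fun _ _ _ => 0

lemma aug_one (x : X) : aug (one V x) = 1 := fold_one (M := fun _ => K) _ _

lemma aug_cons {x y z : X} {n : ℤ} (v : V x y n) (t : Tens V y z) : aug (cons v t) = 0 :=
  fold_cons (M := fun _ => K) _ _ v t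

lemma aug_mul {x y z : X} (a : Tens V x y) (b : Tens V y z) :
    aug (mul a b) = aug a * aug b := by
  refine induction (P := fun x a => aug (mul a b) = aug a * aug b) (by simp)
    (fun x s t hs ht => by simp only [map_add, LinearMap.add_apply, hs, ht, add_mul])
    (fun c => ?_) (fun x y n v t _ => ?_) a
  · simp only [map_smul, LinearMap.smul_apply, one_mul, aug_one, smul_eq_mul, _root_.mul_one]
  · rw [cons_mul, aug_cons, aug_cons, zero_mul]

lemma aug_eq_zero_of_ne {x z : X} (h : x ≠ z) (t : Tens V x z) : aug t = 0 := by
  refine induction (P := fun x t => x ≠ z → aug t = 0) (fun _ _ => map_zero _)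
    (fun x s t hs ht h => by rw [map_add, hs h, ht h, add_zero])
    (fun c h => absurd rfl h) (fun x y n v t _ _ => aug_cons v t) t h

/-- The augmentation kills boundaries as soon as it kills the differentials of the generators. -/
lemma aug_der {δ : ∀ (x y : X) (n : ℤ), V x y n →ₗ[K] Tens V x y}
    (hδ : ∀ x y n (v : V x y n), aug (δ x y n v) = 0) {x z : X} (t : Tens V x z) :
    aug (der δ t) = 0 := by
  refine induction (P := fun x t => aug (der δ t) = 0) (by simp)
    (fun x s t hs ht => by simp only [map_add, hs, ht, add_zero])
    (fun c => by rw [map_smul, der_one, smul_zero, map_zero]) (fun x y n v t _ => ?_) t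
  rw [der_cons, map_add, map_smul, aug_mul, hδ, aug_cons, zero_mul, smul_zero, add_zero]

end Tens

namespace CurvedCocat

variable {K : Type u} [Field K]

lemma aug_cobarGen (C : CurvedCocat K) (hθ : ∀ x y n, C.θ x y n = 0) (x z : C.Obj) (n : ℤ)
    (c : C.hom x z n) : Tens.aug (C.cobarGen x z n c) = 0 := by
  have hs : ∀ s : Decomp C.hom x z n, Tens.aug (signTens s) = 0 := fun s =>
    Decomp.ext (Tens.aug ∘ₗ signTens) 0 (fun y p q h v w => by
      rw [LinearMap.comp_apply, signTens_tmul, map_smul, Tens.aug_cons, smul_zero,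
        LinearMap.zero_apply]) s
  rw [cobarGen_apply, hθ, LinearMap.zero_apply, zero_smul, map_sub, map_sub, map_zero, hs,
    Tens.gen_apply, Tens.aug_cons]
  simp

/-- Without curvature, distinct objects of the cobar construction are never homotopy
equivalent. -/
lemma eq_of_iso_of_θ_eq_zero (C : CurvedCocat K) (hθ : ∀ x y n, C.θ x y n = 0)
    {x y : C.Obj} (e : (⟨x⟩ : DGCat.H0 C.cobar) ≅ ⟨y⟩) : x = y := by
  by_contra hxy
  obtain ⟨f, g, hfg, -⟩ := e
  obtain ⟨a, rfl⟩ := Submodule.Quotient.mk_surjective _ f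
  obtain ⟨b, rfl⟩ := Submodule.Quotient.mk_surjective _ g
  obtain ⟨c, hc⟩ := (Submodule.Quotient.eq _).1 hfg
  obtain ⟨⟨a, _⟩, _⟩ := a
  obtain ⟨⟨b, _⟩, _⟩ := b
  obtain ⟨c, hc'⟩ := c
  have key : Tens.der C.cobarGen c = Tens.mul (y := y) a b - Tens.one C.hom x :=
    (C.cobarHom_d (zero_add 1) ⟨c, hc'⟩).symm.trans (congrArg Subtype.val hc)
  have h : (0 : K) = Tens.aug a * Tens.aug b - 1 := by
    rw [← Tens.aug_mul, ← Tens.aug_one (V := C.hom) x, ← map_sub]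
    exact (Tens.aug_der (C.aug_cobarGen hθ) c).symm.trans (congrArg Tens.aug key)
  rw [Tens.aug_eq_zero_of_ne hxy, zero_mul, zero_sub] at h
  exact one_ne_zero (neg_eq_zero.1 h.symm)

/-- The discrete cocategory on a set of objects: all its modules of morphisms are zero. -/
def discrete (K : Type u) [Field K] (S : Type u) : CurvedCocat K where
  Obj := S
  hom _ _ _ := ModuleCat.of K PUnit
  Δ _ _ _ := 0
  d _ _ _ _ _ := 0
  θ _ _ _ := 0
  θ_eq_zero _ _ _ _ := rfl
  coassoc _ _ _ _ := by simp only [LinearMap.zero_apply, map_zero]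
  conilpotent x z n c := ⟨0, map_zero (Tens.gen (V := fun _ _ _ => ModuleCat.of K PUnit))⟩
  Δ_d _ _ _ _ _ _ := by simp only [LinearMap.zero_apply, map_zero]
  d_d _ _ _ _ _ _ _ _ := rfl
  θ_d _ _ _ _ _ _ := rfl

/-- The morphism of discrete cocategories given by a map of sets. -/
def discreteMap (K : Type u) [Field K] {S T : Type u} (f : S → T) :
    discrete K S ⟶ discrete K T :=
  show Hom _ _ from
  { obj := f
    map := fun _ _ _ => 0
    map_Δ := fun x z n _ => (map_zero (Decomp.map (V := (discrete K S).hom)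
      (W := (discrete K T).hom) f (fun _ _ _ => 0) (x := x) (z := z) (n := n))).symm
    map_d := fun _ _ _ _ _ _ => rfl
    map_θ := fun _ _ _ _ => rfl }

lemma θ_eq_zero_of_hom_discrete {C : CurvedCocat K} {S : Type u} (p : C ⟶ discrete K S)
    (x y : C.Obj) (n : ℤ) : C.θ x y n = 0 :=
  LinearMap.ext fun c => (Hom.map_θ p x y n c).symm

end CurvedCocat

namespace DGCat

variable {K : Type u} [Field K]

/-- The indiscrete dg category on a set of objects: all its complexes of morphisms are zero. -/
def indiscrete (K : Type u) [Field K] (S : Type u) : DGCat K where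
  Obj := S
  Hom _ _ := { X := fun _ => ModuleCat.of K PUnit, d := fun _ _ => 0 }
  comp _ := 0
  one _ := PUnit.unit
  one_comp _ := rfl
  comp_one _ := rfl
  assoc _ _ _ _ _ _ _ := rfl
  leibniz _ _ _ _ _ _ := rfl

lemma isZero_indiscrete_hom {S : Type u} (x y : S) :
    Limits.IsZero ((indiscrete K S).Hom x y) := by
  rw [Limits.IsZero.iff_id_eq_zero]
  rfl

/-- Dg functors to an indiscrete dg category are maps on objects. -/
def toIndiscrete {A : DGCat K} {S : Type u} (f : A.Obj → S) : A ⟶ indiscrete K S :=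
  show Functor _ _ from
  { obj := f
    map := fun _ _ => 0
    map_one := fun _ => rfl
    map_comp := fun _ _ _ => rfl }

lemma toIndiscrete_ext {A : DGCat K} {S : Type u} {F G : A ⟶ indiscrete K S}
    (h : Functor.obj F = Functor.obj G) : F = G := by
  obtain ⟨f, φ, _, _⟩ := F
  obtain ⟨g, ψ, _, _⟩ := G
  obtain rfl : f = g := h
  refine Functor.ext rfl (heq_of_eq ?_)
  funext x y
  exact (isZero_indiscrete_hom _ _).eq_of_tgt _ _

instance {S : Type u} (x y : H0 (indiscrete K S)) : Unique (x ⟶ y) where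
  default := Submodule.Quotient.mk 0
  uniq := by
    rintro ⟨a⟩
    exact congrArg Submodule.Quotient.mk (Subtype.ext rfl)

/-- The indiscrete dg category on a nonempty set is contractible. -/
lemma toIndiscrete_trivialFibration {S : Type u} [Nonempty S] :
    (fibrations K ⊓ weakEquivalences K)
      (toIndiscrete (fun _ => PUnit.unit) : indiscrete K S ⟶ indiscrete K PUnit.{u + 1}) := by
  refine ⟨⟨fun x y n b => ⟨0, Subsingleton.elim (α := PUnit) _ _⟩, fun x y e => ?_⟩,
    fun x y => ?_, ?_⟩
  · exact ⟨x, Iso.refl x, rfl, Subsingleton.elim _ _⟩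
  · have : IsIso (Functor.map
        (toIndiscrete (fun _ => PUnit.unit) : indiscrete K S ⟶ indiscrete K PUnit.{u + 1}) x y) :=
      ⟨0, (isZero_indiscrete_hom _ _).eq_of_src _ _, (isZero_indiscrete_hom _ _).eq_of_src _ _⟩
    infer_instance
  · refine { faithful := ⟨fun _ => Subsingleton.elim _ _⟩
             full := ⟨fun g => ⟨default, Subsingleton.elim _ _⟩⟩
             essSurj := ⟨fun y => ⟨⟨Classical.arbitrary S⟩, ⟨?_⟩⟩⟩ }
    exact ⟨default, default, Subsingleton.elim _ _, Subsingleton.elim _ _⟩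

lemma obj_injective_of_cofibrations {A B : DGCat K} {F : A ⟶ B} (hF : cofibrations K F) :
    Function.Injective (Functor.obj F) := by
  rcases isEmpty_or_nonempty A.Obj with hA | hA
  · exact Function.injective_of_subsingleton _
  · have := hF _ (toIndiscrete_trivialFibration (S := A.Obj))
    have sq : CommSq (toIndiscrete id) F
        (toIndiscrete (fun _ => PUnit.unit) : indiscrete K A.Obj ⟶ indiscrete K PUnit.{u + 1})
        (toIndiscrete fun _ => PUnit.unit) := ⟨toIndiscrete_ext rfl⟩
    -- A lift of the identity of the objects of `A` is a left inverse of `F` on objects.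
    have h := congrArg Functor.obj sq.fac_left
    exact Function.LeftInverse.injective (g := Functor.obj sq.lift) (congrFun h)

end DGCat

end

end CobarCat

theorem mainTheorem11 (K : Type u) [Field K] [CharZero K] :
    ¬ ∃ _ : HomotopicalAlgebra.ModelCategory (CobarCat.CurvedCocat K),
      (∀ (C D : CobarCat.CurvedCocat K) (f : C ⟶ D),
        HomotopicalAlgebra.cofibrations (CobarCat.CurvedCocat K) f →
          CobarCat.DGCat.cofibrations K ((CobarCat.CurvedCocat.cobarFunctor K).map f)) ∧
      (∀ (C D : CobarCat.CurvedCocat K) (f : C ⟶ D),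
        HomotopicalAlgebra.weakEquivalences (CobarCat.CurvedCocat K) f →
          CobarCat.DGCat.weakEquivalences K ((CobarCat.CurvedCocat.cobarFunctor K).map f)) := by
  rintro ⟨_, hcof, hweq⟩
  -- Factor the fold map `{0, 1} → {0}` as `{0, 1} → J → {0}`, with `J = φ.Z`.
  let fold := CobarCat.CurvedCocat.discreteMap K (fun _ : ULift.{u} Bool => PUnit.unit.{u + 1})
  let φ := MorphismProperty.factorizationData
    (HomotopicalAlgebra.cofibrations (CobarCat.CurvedCocat K))
    (HomotopicalAlgebra.trivialFibrations (CobarCat.CurvedCocat K)) fold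
  have hi := CobarCat.DGCat.obj_injective_of_cofibrations (hcof _ _ _ φ.hi)
  have := (hweq _ _ _ φ.hp.2).2
  let F := CobarCat.DGCat.Functor.H0 ((CobarCat.CurvedCocat.cobarFunctor K).map φ.p)
  -- All objects of `H₀(Ω_u {0})` are equal, so all objects of `H₀(Ω_u J)` are isomorphic.
  have e : ∀ x y : CobarCat.DGCat.H0 φ.Z.cobar, Nonempty (x ≅ y) := fun x y =>
    ⟨F.preimageIso (eqToIso (show F.obj x = F.obj y from rfl))⟩
  obtain ⟨e⟩ := e ⟨CobarCat.CurvedCocat.Hom.obj φ.i ⟨false⟩⟩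
    ⟨CobarCat.CurvedCocat.Hom.obj φ.i ⟨true⟩⟩
  have h := hi (φ.Z.eq_of_iso_of_θ_eq_zero
    (CobarCat.CurvedCocat.θ_eq_zero_of_hom_discrete φ.p) e)
  exact Bool.false_ne_true (congrArg ULift.down h)
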